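/- Let $1<s<2$, $r>0$ and $\delta>0$. There exists a constant $c>0$, depending only on $s$, $r$ and $\delta$, such that the following holds for every integer $q\ge 1$ and every set $P\subset[0,q]^2$ that contains a point in each closed unit lattice square $[i,i+1]\times[j,j+1]$, $0\le i,j<q$ ($i,j$ integers), and whose distinct points are at distance at least $\delta$ from each other. Put $\rho_q=q^{-2/s}$ and let $$E_q=\bigl\{x\in\mathbb R^2:\ |x-q^{-1}p|<\rho_q\ \text{for some } p\in P\bigr\}$$ be the $\rho_q$-neighbourhood of $q^{-1}P$. Then, with $|\cdot|$ denoting planar Lebesgue measure of sets, $$\Bigl|\bigcup_{x\in E_q}\{y\in\mathbb R^2:\ |x-y|=r\}\Bigr|\ \ge\ c .$$ Equivalently, after rescaling (note $q\rho_q=q^{1-2/s}$), $$\Bigl|\bigcup_{p\in P}\bigl\{z\in\mathbb R^2:\ \bigl||z-p|-rq\bigr|\le q^{1-2/s}\bigr\}\Bigr|\ \ge\ c\,q^2 ;$$ indeed the measure of this union of annuli is exactly $q^2$ times the measure of the preceding union of circles. -/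

import Mathlib

namespace SeparatedAnnuli

/-- The Euclidean plane. -/
abbrev Plane := EuclideanSpace ℝ (Fin 2)

/-- The closed unit lattice square `[i, i+1] × [j, j+1]`. -/
def latticeSquare (i j : ℕ) : Set Plane :=
  {x | x 0 ∈ Set.Icc (i : ℝ) (i + 1) ∧ x 1 ∈ Set.Icc (j : ℝ) (j + 1)}

/-- `P ⊆ [0,q]²` contains a point in each of the `q²` unit lattice squares of `[0,q]²`, and
distinct points of `P` are at distance at least `δ`. -/
structure IsLatticeSample (q : ℕ) (δ : ℝ) (P : Set Plane) : Prop where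
  subset_square : ∀ p ∈ P, ∀ k : Fin 2, p k ∈ Set.Icc (0 : ℝ) q
  exists_mem_latticeSquare : ∀ i < q, ∀ j < q, ∃ p ∈ P, p ∈ latticeSquare i j
  separated : P.Pairwise fun p p' => δ ≤ dist p p'

/-- The scale `ρ_q = q^{-2/s}`. -/
noncomputable def scale (s : ℝ) (q : ℕ) : ℝ := (q : ℝ) ^ (-(2 / s))

/-- The set `E_q`: the (open) `ρ_q`-neighbourhood of `q⁻¹ P`. -/
noncomputable def scaledNhd (s : ℝ) (q : ℕ) (P : Set Plane) : Set Plane :=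
  Metric.thickening (scale s q) ((fun p => (q : ℝ)⁻¹ • p) '' P)

/-- The union of all circles of radius `r` with centre in `E`. -/
def circleUnion (r : ℝ) (E : Set Plane) : Set Plane :=
  ⋃ x ∈ E, {y | dist x y = r}

/-- The union over `p ∈ P` of the annuli `{z : ||z - p| - R| ≤ w}`. -/
def annulusUnion (R w : ℝ) (P : Set Plane) : Set Plane :=
  ⋃ p ∈ P, {z | |dist z p - R| ≤ w}

end SeparatedAnnuli

namespace SeparatedAnnuli

open MeasureTheory
open scoped Pointwise

/-- A quadratic lower bound for the measure of a finite union. -/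
theorem measureReal_biUnion_ge {α ι : Type*} [MeasurableSpace α] {μ : Measure α}
    (s : Finset ι) (B : ι → Set α) (hB : ∀ i ∈ s, MeasurableSet (B i))
    (hfin : ∀ i ∈ s, μ (B i) ≠ ⊤) (L : ℝ) :
    2 * L * ∑ i ∈ s, μ.real (B i) - L ^ 2 * ∑ i ∈ s, ∑ j ∈ s, μ.real (B i ∩ B j) ≤
      μ.real (⋃ i ∈ s, B i) := by
  have hU : MeasurableSet (⋃ i ∈ s, B i) := Finset.measurableSet_biUnion s hB
  have hUfin : μ (⋃ i ∈ s, B i) ≠ ⊤ :=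
    ((measure_biUnion_lt_top s.finite_toSet (fun i hi => (hfin i hi).lt_top))).ne
  have hint1 : ∀ i ∈ s, Integrable ((B i).indicator (1 : α → ℝ)) μ := fun i hi =>
    (integrable_indicator_iff (hB i hi)).2 (integrableOn_const (hfin i hi))
  have hint2 : ∀ i ∈ s, ∀ j ∈ s, Integrable ((B i ∩ B j).indicator (1 : α → ℝ)) μ :=
    fun i hi j hj => (integrable_indicator_iff ((hB i hi).inter (hB j hj))).2
      (integrableOn_const (measure_ne_top_of_subset Set.inter_subset_left (hfin i hi)))
  have hint3 : ∀ i ∈ s, Integrable (fun x => ∑ j ∈ s, (B i ∩ B j).indicator (1 : α → ℝ) x) μ :=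
    fun i hi => integrable_finsetSum _ (hint2 i hi)
  have hI1 : Integrable (fun x => 2 * L * ∑ i ∈ s, (B i).indicator (1 : α → ℝ) x) μ :=
    (integrable_finsetSum _ hint1).const_mul _
  have hI2 : Integrable
      (fun x => L ^ 2 * ∑ i ∈ s, ∑ j ∈ s, (B i ∩ B j).indicator (1 : α → ℝ) x) μ :=
    (integrable_finsetSum _ hint3).const_mul _
  have e1 : ∫ x, 2 * L * ∑ i ∈ s, (B i).indicator (1 : α → ℝ) x ∂μ =
      2 * L * ∑ i ∈ s, μ.real (B i) := by
    rw [integral_const_mul, integral_finsetSum _ hint1]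
    congr 1
    exact Finset.sum_congr rfl fun i hi => integral_indicator_one (hB i hi)
  have e2 : ∫ x, L ^ 2 * ∑ i ∈ s, ∑ j ∈ s, (B i ∩ B j).indicator (1 : α → ℝ) x ∂μ =
      L ^ 2 * ∑ i ∈ s, ∑ j ∈ s, μ.real (B i ∩ B j) := by
    rw [integral_const_mul, integral_finsetSum _ hint3]
    congr 1
    refine Finset.sum_congr rfl fun i hi => ?_
    rw [integral_finsetSum _ (hint2 i hi)]
    exact Finset.sum_congr rfl fun j hj => integral_indicator_one ((hB i hi).inter (hB j hj))
  rw [← e1, ← e2, ← integral_sub hI1 hI2, ← integral_indicator_one hU]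
  refine integral_mono (hI1.sub hI2)
    ((integrable_indicator_iff hU).2 (integrableOn_const hUfin)) fun x => ?_
  have hsq : ∑ i ∈ s, ∑ j ∈ s, (B i ∩ B j).indicator (1 : α → ℝ) x =
      (∑ i ∈ s, (B i).indicator (1 : α → ℝ) x) ^ 2 := by
    rw [sq, Finset.sum_mul_sum]
    refine Finset.sum_congr rfl fun i _ => Finset.sum_congr rfl fun j _ => ?_
    rw [Set.inter_indicator_one]; rfl
  simp only [hsq]
  by_cases hx : x ∈ ⋃ i ∈ s, B i
  · rw [Set.indicator_of_mem hx, Pi.one_apply]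
    nlinarith [sq_nonneg (1 - L * ∑ i ∈ s, (B i).indicator (1 : α → ℝ) x)]
  · have : ∑ i ∈ s, (B i).indicator (1 : α → ℝ) x = 0 :=
      Finset.sum_eq_zero fun i hi => Set.indicator_of_notMem
        (fun h => hx (Set.mem_biUnion (Finset.mem_coe.2 hi) h)) _
    simp [this, Set.indicator_of_notMem hx]

theorem hasDerivAt_sqrt_sq_sub_sq {R t : ℝ} (ht : t ^ 2 < R ^ 2) :
    HasDerivAt (fun t => √(R ^ 2 - t ^ 2)) (-(t / √(R ^ 2 - t ^ 2))) t := by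
  have h : HasDerivAt (fun t => R ^ 2 - t ^ 2) (-(2 * t)) t := by
    simpa using (hasDerivAt_pow 2 t).const_sub (R ^ 2)
  convert h.sqrt (by linarith) using 1
  ring

/-- The slope of the upper half circle of radius `R` decreases at rate at least `1 / R`. -/
theorem sub_div_le_slope_sub_slope {R u v : ℝ} (hR : 0 < R) (hvu : v ≤ u)
    (hu : u ^ 2 < R ^ 2) (hv : v ^ 2 < R ^ 2) :
    (u - v) / R ≤ u / √(R ^ 2 - u ^ 2) - v / √(R ^ 2 - v ^ 2) := by
  have key : ∀ x ∈ Set.Icc v u, x ^ 2 < R ^ 2 := fun x hx =>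
    sq_lt_sq' (by have := abs_lt_of_sq_lt_sq hv hR.le; rw [abs_lt] at this; linarith [hx.1])
      (by have := abs_lt_of_sq_lt_sq hu hR.le; rw [abs_lt] at this; linarith [hx.2])
  have hder : ∀ x ∈ Set.Icc v u, HasDerivAt (fun t => t / √(R ^ 2 - t ^ 2))
      (R ^ 2 / √(R ^ 2 - x ^ 2) ^ 3) x := fun x hx => by
    have hpos : 0 < R ^ 2 - x ^ 2 := by linarith [key x hx]
    have hs := Real.sqrt_pos.2 hpos
    refine ((hasDerivAt_id' x).div (hasDerivAt_sqrt_sq_sub_sq (key x hx)) hs.ne').congr_deriv ?_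
    have := Real.sq_sqrt hpos.le
    field_simp
    linarith
  have := (convex_Icc v u).mul_sub_le_image_sub_of_le_deriv
    (f := fun t => t / √(R ^ 2 - t ^ 2)) (C := 1 / R)
    (fun x hx => (hder x hx).continuousAt.continuousWithinAt)
    (fun x hx => (hder x (interior_subset hx)).differentiableAt.differentiableWithinAt)
    (fun x hx => by
      have hx := interior_subset hx
      have hpos : 0 < R ^ 2 - x ^ 2 := by linarith [key x hx]
      have hs := Real.sqrt_pos.2 hpos
      rw [(hder x hx).deriv, div_le_div_iff₀ hR (by positivity)]
      have : √(R ^ 2 - x ^ 2) ≤ R := Real.sqrt_le_iff.2 ⟨hR.le, by nlinarith⟩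
      calc 1 * √(R ^ 2 - x ^ 2) ^ 3 ≤ R ^ 3 := by rw [one_mul]; gcongr
        _ = _ := by ring)
    v (Set.left_mem_Icc.2 hvu) u (Set.right_mem_Icc.2 hvu) hvu
  simpa [div_eq_inv_mul] using this

theorem abs_sqrt_sub_sqrt_le {R u v : ℝ} (hR : 0 < R) (hu : |u| ≤ R / 2) (hv : |v| ≤ R / 2) :
    |√(R ^ 2 - u ^ 2) - √(R ^ 2 - v ^ 2)| ≤ |u - v| := by
  have h : ∀ x, |x| ≤ R / 2 → R / 2 ≤ √(R ^ 2 - x ^ 2) := fun x hx => by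
    have := sq_le_sq' (by linarith [neg_abs_le x, abs_nonneg x]) hx
    rw [sq_abs] at this
    exact Real.le_sqrt_of_sq_le (by nlinarith)
  have hu' := h u hu
  have hv' := h v hv
  have hpos : ∀ x, R / 2 ≤ √(R ^ 2 - x ^ 2) → √(R ^ 2 - x ^ 2) ^ 2 = R ^ 2 - x ^ 2 :=
    fun x hx => Real.sq_sqrt (Real.sqrt_pos.1 (by linarith)).le
  have hsum : R ≤ √(R ^ 2 - u ^ 2) + √(R ^ 2 - v ^ 2) := by linarith
  have heq : (√(R ^ 2 - u ^ 2) - √(R ^ 2 - v ^ 2)) * (√(R ^ 2 - u ^ 2) + √(R ^ 2 - v ^ 2)) =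
      -((u - v) * (u + v)) := by
    linear_combination hpos u hu' - hpos v hv'
  have habs := congrArg abs heq
  rw [abs_mul, abs_neg, abs_mul, abs_of_nonneg (by linarith : 0 ≤ √(R ^ 2 - u ^ 2) + _)] at habs
  have huv : |u + v| ≤ R := (abs_add_le u v).trans (by linarith)
  refine le_of_mul_le_mul_right ?_ hR
  calc _ ≤ _ := mul_le_mul_of_nonneg_left hsum (abs_nonneg _)
    _ = |u - v| * |u + v| := habs
    _ ≤ _ := by gcongr

/-- Two translated arcs separate at speed at least `|a - b| / R`. -/
theorem sub_mul_le_arc_sub {R a b x y : ℝ} (hR : 0 < R) (hab : a ≤ b) (hxy : x ≤ y)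
    (hxb : |x - b| ≤ R / 2) (hya : |y - a| ≤ R / 2) :
    (b - a) / R * (y - x) ≤
      (√(R ^ 2 - (y - b) ^ 2) - √(R ^ 2 - (y - a) ^ 2)) -
        (√(R ^ 2 - (x - b) ^ 2) - √(R ^ 2 - (x - a) ^ 2)) := by
  rw [abs_le] at hxb hya
  have ha : ∀ t ∈ Set.Icc x y, (t - a) ^ 2 < R ^ 2 := fun t ht =>
    sq_lt_sq' (by linarith [ht.1]) (by linarith [ht.2])
  have hb : ∀ t ∈ Set.Icc x y, (t - b) ^ 2 < R ^ 2 := fun t ht =>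
    sq_lt_sq' (by linarith [ht.1]) (by linarith [ht.2])
  have hder : ∀ t ∈ Set.Icc x y,
      HasDerivAt (fun t => √(R ^ 2 - (t - b) ^ 2) - √(R ^ 2 - (t - a) ^ 2))
        (-((t - b) / √(R ^ 2 - (t - b) ^ 2)) - -((t - a) / √(R ^ 2 - (t - a) ^ 2))) t :=
    fun t ht => ((hasDerivAt_sqrt_sq_sub_sq (hb t ht)).comp_sub_const t b).sub
      ((hasDerivAt_sqrt_sq_sub_sq (ha t ht)).comp_sub_const t a)
  refine (convex_Icc x y).mul_sub_le_image_sub_of_le_deriv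
    (f := fun t => √(R ^ 2 - (t - b) ^ 2) - √(R ^ 2 - (t - a) ^ 2))
    (fun t ht => (hder t ht).continuousAt.continuousWithinAt)
    (fun t ht => (hder t (interior_subset ht)).differentiableAt.differentiableWithinAt)
    (fun t ht => ?_) x (Set.left_mem_Icc.2 hxy) y (Set.right_mem_Icc.2 hxy) hxy
  have ht := interior_subset ht
  rw [(hder t ht).deriv]
  have := sub_div_le_slope_sub_slope hR (by linarith : t - b ≤ t - a) (ha t ht) (hb t ht)
  rw [show t - a - (t - b) = b - a by ring] at this
  linarith

/-- The vertical `w`-neighbourhood of the arc of the circle of radius `R` about `p` that lies over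
`[p₁ - R / 2, p₁ + R / 2]` in the upper half. -/
def arcBand (R w : ℝ) (p : ℝ × ℝ) : Set (ℝ × ℝ) :=
  {z | |z.1 - p.1| ≤ R / 2 ∧ |z.2 - p.2 - √(R ^ 2 - (z.1 - p.1) ^ 2)| ≤ w}

theorem measurableSet_arcBand (R w : ℝ) (p : ℝ × ℝ) : MeasurableSet (arcBand R w p) := by
  refine (IsClosed.inter (s₁ := {z : ℝ × ℝ | |z.1 - p.1| ≤ R / 2})
    (s₂ := {z : ℝ × ℝ | |z.2 - p.2 - √(R ^ 2 - (z.1 - p.1) ^ 2)| ≤ w}) ?_ ?_).measurableSet <;>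
  exact isClosed_le (by fun_prop) continuous_const

theorem prodMk_preimage_arcBand (R w : ℝ) (p : ℝ × ℝ) (x : ℝ) (hx : |x - p.1| ≤ R / 2) :
    Prod.mk x ⁻¹' arcBand R w p = Metric.closedBall (p.2 + √(R ^ 2 - (x - p.1) ^ 2)) w := by
  ext y
  simp [arcBand, hx, Real.dist_eq, sub_sub]

theorem volume_prodMk_preimage_arcBand (R w : ℝ) (p : ℝ × ℝ) (x : ℝ) :
    volume (Prod.mk x ⁻¹' arcBand R w p) =
      (Metric.closedBall p.1 (R / 2)).indicator (fun _ => ENNReal.ofReal (2 * w)) x := by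
  by_cases hx : |x - p.1| ≤ R / 2
  · rw [prodMk_preimage_arcBand R w p x hx, Real.volume_closedBall,
      Set.indicator_of_mem (by simpa [Real.dist_eq] using hx)]
  · rw [Set.indicator_of_notMem (by simpa [Real.dist_eq] using hx)]
    convert measure_empty (μ := (volume : Measure ℝ))
    ext y
    simp [arcBand, hx]

theorem volume_arcBand {R w : ℝ} (hw : 0 ≤ w) (p : ℝ × ℝ) :
    volume (arcBand R w p) = ENNReal.ofReal (2 * w * R) := by
  rw [Measure.volume_eq_prod, Measure.prod_apply (measurableSet_arcBand R w p)]
  simp_rw [volume_prodMk_preimage_arcBand]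
  rw [lintegral_indicator_const Metric.isClosed_closedBall.measurableSet, Real.volume_closedBall,
    ← ENNReal.ofReal_mul (by positivity)]
  congr 2
  ring

theorem measureReal_arcBand {R w : ℝ} (hR : 0 ≤ R) (hw : 0 ≤ w) (p : ℝ × ℝ) :
    volume.real (arcBand R w p) = 2 * w * R := by
  rw [measureReal_def, volume_arcBand hw, ENNReal.toReal_ofReal (by positivity)]

theorem abs_sub_le_of_mem_arcBand {R w x y : ℝ} {p p' : ℝ × ℝ} (h : (x, y) ∈ arcBand R w p)
    (h' : (x, y) ∈ arcBand R w p') :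
    |p'.2 - p.2 + (√(R ^ 2 - (x - p'.1) ^ 2) - √(R ^ 2 - (x - p.1) ^ 2))| ≤ 2 * w := by
  have h1 := h.2
  have h2 := h'.2
  simp only [abs_le] at h1 h2 ⊢
  constructor <;> linarith

theorem abs_snd_sub_snd_le_of_arcBand_inter {R w : ℝ} (hR : 0 < R) {p p' : ℝ × ℝ}
    (h : (arcBand R w p ∩ arcBand R w p').Nonempty) :
    |p.2 - p'.2| ≤ 2 * w + |p.1 - p'.1| := by
  obtain ⟨⟨x, y⟩, hp, hp'⟩ := h
  have h1 := abs_sub_le_of_mem_arcBand hp hp'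
  have h2 := abs_sqrt_sub_sqrt_le hR hp.1 hp'.1
  rw [show x - p.1 - (x - p'.1) = -(p.1 - p'.1) by ring, abs_neg] at h2
  simp only [abs_le] at h1 h2 ⊢
  constructor <;> linarith

theorem measureReal_arcBand_inter_le_of_lt {R w : ℝ} (hR : 0 < R) (hw : 0 ≤ w) {p p' : ℝ × ℝ}
    (hpp : p.1 < p'.1) :
    volume.real (arcBand R w p ∩ arcBand R w p') ≤ 8 * w ^ 2 * R / (p'.1 - p.1) := by
  set S : Set ℝ := {x | ∃ y, (x, y) ∈ arcBand R w p ∩ arcBand R w p'} with hS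
  have hd : 0 < p'.1 - p.1 := sub_pos.2 hpp
  have hle : ∀ x ∈ S, ∀ y ∈ S, x ≤ y → y - x ≤ 4 * w * R / (p'.1 - p.1) := by
    rintro x ⟨u, hu, hu'⟩ y ⟨v, hv, hv'⟩ hxy
    have h1 := abs_le.1 (abs_sub_le_of_mem_arcBand hu hu')
    have h2 := abs_le.1 (abs_sub_le_of_mem_arcBand hv hv')
    have h3 := sub_mul_le_arc_sub hR hpp.le hxy hu'.1 hv.1
    rw [le_div_iff₀ hd]
    have h4 : (p'.1 - p.1) / R * (y - x) ≤ 4 * w := by linarith [h1.1, h1.2, h2.1, h2.2]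
    rw [div_mul_eq_mul_div, div_le_iff₀ hR] at h4
    linarith
  have hSvol : volume S ≤ ENNReal.ofReal (4 * w * R / (p'.1 - p.1)) := by
    refine (Real.volume_le_diam S).trans (Metric.ediam_le fun x hx y hy => ?_)
    rw [edist_dist, Real.dist_eq]
    refine ENNReal.ofReal_le_ofReal ?_
    rcases le_total x y with h | h
    · rw [abs_sub_comm, abs_of_nonneg (sub_nonneg.2 h)]
      exact hle x hx y hy h
    · rw [abs_of_nonneg (sub_nonneg.2 h)]
      exact hle y hy x hx h
  have hvol : volume (arcBand R w p ∩ arcBand R w p') ≤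
      ENNReal.ofReal (8 * w ^ 2 * R / (p'.1 - p.1)) := by
    rw [Measure.volume_eq_prod, Measure.prod_apply
      ((measurableSet_arcBand R w p).inter (measurableSet_arcBand R w p'))]
    calc _ ≤ ∫⁻ x, S.indicator (fun _ => ENNReal.ofReal (2 * w)) x := by
          refine lintegral_mono fun x => ?_
          by_cases hx : x ∈ S
          · rw [Set.indicator_of_mem hx]
            refine (measure_mono (Set.preimage_mono Set.inter_subset_left)).trans ?_
            rw [volume_prodMk_preimage_arcBand]
            exact Set.indicator_le_self _ _ _
          · rw [Set.indicator_of_notMem hx, nonpos_iff_eq_zero]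
            convert measure_empty (μ := (volume : Measure ℝ))
            exact Set.eq_empty_of_forall_notMem fun y hy => hx ⟨y, hy⟩
      _ ≤ ENNReal.ofReal (2 * w) * volume S := lintegral_indicator_const_le _ _
      _ ≤ ENNReal.ofReal (2 * w) * ENNReal.ofReal (4 * w * R / (p'.1 - p.1)) := by gcongr
      _ = _ := by
        rw [← ENNReal.ofReal_mul (by positivity)]
        congr 1
        ring
  exact ENNReal.toReal_le_of_le_ofReal (by positivity) hvol

theorem measureReal_arcBand_inter_le {R w : ℝ} (hR : 0 < R) (hw : 0 ≤ w) {p p' : ℝ × ℝ}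
    (hpp : p.1 ≠ p'.1) :
    volume.real (arcBand R w p ∩ arcBand R w p') ≤ 8 * w ^ 2 * R / |p.1 - p'.1| := by
  rcases hpp.lt_or_gt with h | h
  · rw [abs_sub_comm, abs_of_pos (sub_pos.2 h)]
    exact measureReal_arcBand_inter_le_of_lt hR hw h
  · rw [Set.inter_comm, abs_of_pos (sub_pos.2 h)]
    exact measureReal_arcBand_inter_le_of_lt hR hw h

theorem measureReal_arcBand_inter_le_self {R w : ℝ} (hR : 0 ≤ R) (hw : 0 ≤ w) (p p' : ℝ × ℝ) :
    volume.real (arcBand R w p ∩ arcBand R w p') ≤ 2 * w * R := by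
  rw [← measureReal_arcBand hR hw p]
  exact measureReal_mono Set.inter_subset_left
    (by rw [volume_arcBand hw]; exact ENNReal.ofReal_ne_top)

/-- At most `2 n + 1` integers of `[0, q)` lie within distance `n` of a given one. -/
theorem card_filter_abs_sub_le (q i n : ℕ) :
    ((Finset.range q).filter fun k : ℕ => |(i : ℤ) - k| ≤ n).card ≤ 2 * n + 1 := by
  calc _ ≤ (Finset.Icc (i - n) (i + n)).card := by
        refine Finset.card_le_card fun k hk => ?_
        rw [Finset.mem_filter, abs_le] at hk
        rw [Finset.mem_Icc]
        omega
    _ ≤ _ := by rw [Nat.card_Icc]; omega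

/-- The total overlap of one arc band with those of one column of a unit grid. -/
theorem sum_column_measureReal_arcBand_inter_le {R w : ℝ} (hR : 0 < R) (hw : 0 ≤ w) (hw1 : w ≤ 1)
    {q : ℕ} {P : ℕ → ℕ → ℝ × ℝ}
    (h1 : ∀ i < q, ∀ j < q, (P i j).1 ∈ Set.Icc (i : ℝ) (i + 1))
    (h2 : ∀ i < q, ∀ j < q, (P i j).2 ∈ Set.Icc (j : ℝ) (j + 1))
    {i j k : ℕ} (hi : i < q) (hj : j < q) (hk : k < q) :
    ∑ l ∈ Finset.range q, volume.real (arcBand R w (P i j) ∩ arcBand R w (P k l)) ≤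
      112 * w ^ 2 * R + if |(i : ℤ) - k| ≤ (1 : ℕ) then 22 * w * R else 0 := by
  obtain ⟨m, hm⟩ : ∃ m : ℕ, |(i : ℤ) - k| = m := ⟨_, Int.abs_eq_natAbs _⟩
  have hmR : |(i : ℝ) - k| = m := by exact_mod_cast hm
  have hx := h1 i hi j hj
  have hy := h2 i hi j hj
  have hsub : ∀ c, (∀ l < q, volume.real (arcBand R w (P i j) ∩ arcBand R w (P k l)) ≤ c) →
      0 ≤ c → ∑ l ∈ Finset.range q, volume.real (arcBand R w (P i j) ∩ arcBand R w (P k l)) ≤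
        (2 * ((m + 4 : ℕ) : ℝ) + 1) * c := by
    intro c hc hc0
    calc _ ≤ ∑ l ∈ Finset.range q, if |(j : ℤ) - l| ≤ (m + 4 : ℕ) then c else 0 := by
          refine Finset.sum_le_sum fun l hl => ?_
          rw [Finset.mem_range] at hl
          split_ifs with h
          · exact hc l hl
          · have hempty : arcBand R w (P i j) ∩ arcBand R w (P k l) = ∅ := by
              by_contra hne
              have h3 := abs_snd_sub_snd_le_of_arcBand_inter hR (Set.nonempty_iff_ne_empty.2 hne)
              have hx' := h1 k hk l hl
              have hy' := h2 k hk l hl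
              have h4 : |(P i j).1 - (P k l).1| ≤ m + 1 := by
                rw [abs_le]
                have := abs_le.1 hmR.le
                constructor <;> linarith [hx.1, hx.2, hx'.1, hx'.2]
              have h5 : |(j : ℝ) - l| ≤ m + 4 := by
                have := abs_le.1 (h3.trans (add_le_add_right h4 _))
                rw [abs_le]
                constructor <;> linarith [hy.1, hy.2, hy'.1, hy'.2]
              exact h (by exact_mod_cast h5)
            rw [hempty, measureReal_empty]
      _ = ((Finset.range q).filter fun l : ℕ => |(j : ℤ) - l| ≤ (m + 4 : ℕ)).card * c := by
          rw [← Finset.sum_filter, Finset.sum_const, nsmul_eq_mul]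
      _ ≤ _ := by
          gcongr
          exact_mod_cast card_filter_abs_sub_le q j (m + 4)
  rw [hm]
  split_ifs with h
  · have hm1 : (m : ℝ) ≤ 1 := by exact_mod_cast h
    refine (hsub (2 * w * R) (fun l _ => measureReal_arcBand_inter_le_self hR.le hw _ _)
      (by positivity)).trans ?_
    push_cast
    have : 0 ≤ w * R := by positivity
    have : 0 ≤ w ^ 2 * R := by positivity
    nlinarith
  · have hm2 : (2 : ℝ) ≤ m := by
      have : 2 ≤ m := by
        have : ¬ m ≤ 1 := by exact_mod_cast h
        omega
      exact_mod_cast this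
    refine (hsub (16 * w ^ 2 * R / m) (fun l hl => ?_) (by positivity)).trans ?_
    · have hx' := h1 k hk l hl
      have h4 : (m : ℝ) / 2 ≤ |(P i j).1 - (P k l).1| := by
        have h5 : |(i : ℝ) - k| ≤ |(P i j).1 - (P k l).1| + 1 := by
          rw [abs_le]
          have := abs_le.1 (le_refl |(P i j).1 - (P k l).1|)
          constructor <;> linarith [hx.1, hx.2, hx'.1, hx'.2]
        linarith
      have h6 : 0 < |(P i j).1 - (P k l).1| := by linarith
      refine (measureReal_arcBand_inter_le hR hw (sub_ne_zero.1 (abs_pos.1 h6))).trans ?_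
      rw [div_le_div_iff₀ h6 (by linarith)]
      have : 0 ≤ w ^ 2 * R := by positivity
      nlinarith
    · rw [← mul_div_assoc, div_le_iff₀ (by linarith)]
      push_cast
      have : 0 ≤ w ^ 2 * R := by positivity
      nlinarith

theorem measureReal_biUnion_arcBand_ge {r w : ℝ} (hr : 0 < r) (hw : 0 < w) (hw1 : w ≤ 1)
    {q : ℕ} (hq : 1 ≤ q) (hwq : 1 ≤ w * q) {P : ℕ → ℕ → ℝ × ℝ}
    (h1 : ∀ i < q, ∀ j < q, (P i j).1 ∈ Set.Icc (i : ℝ) (i + 1))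
    (h2 : ∀ i < q, ∀ j < q, (P i j).2 ∈ Set.Icc (j : ℝ) (j + 1)) :
    2 * r / 89 * (q : ℝ) ^ 2 ≤
      volume.real (⋃ ij ∈ Finset.range q ×ˢ Finset.range q, arcBand (r * q) w (P ij.1 ij.2)) := by
  have hq0 : (0 : ℝ) < q := by exact_mod_cast hq
  have hR : 0 < r * q := by positivity
  have hsum1 : ∑ ij ∈ Finset.range q ×ˢ Finset.range q,
      volume.real (arcBand (r * q) w (P ij.1 ij.2)) = 2 * r * w * (q : ℝ) ^ 3 := by
    simp_rw [measureReal_arcBand hR.le hw.le]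
    rw [Finset.sum_const, Finset.card_product, Finset.card_range, nsmul_eq_mul]
    push_cast
    ring
  have hone : ∀ i < q, ∀ j < q, ∑ kl ∈ Finset.range q ×ˢ Finset.range q,
      volume.real (arcBand (r * q) w (P i j) ∩ arcBand (r * q) w (P kl.1 kl.2)) ≤
        178 * r * w ^ 2 * (q : ℝ) ^ 2 := fun i hi j hj => by
    rw [Finset.sum_product]
    calc _ ≤ ∑ k ∈ Finset.range q, (112 * w ^ 2 * (r * q) +
          if |(i : ℤ) - k| ≤ (1 : ℕ) then 22 * w * (r * q) else 0) :=
          Finset.sum_le_sum fun k hk => sum_column_measureReal_arcBand_inter_le hR hw.le hw1 h1 h2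
            hi hj (Finset.mem_range.1 hk)
      _ = q * (112 * w ^ 2 * (r * q)) +
          ((Finset.range q).filter fun k : ℕ => |(i : ℤ) - k| ≤ (1 : ℕ)).card *
            (22 * w * (r * q)) := by
          rw [Finset.sum_add_distrib, Finset.sum_const, Finset.card_range, nsmul_eq_mul,
            ← Finset.sum_filter, Finset.sum_const, nsmul_eq_mul]
      _ ≤ q * (112 * w ^ 2 * (r * q)) + 3 * (22 * w * (r * q)) := by
          gcongr
          exact_mod_cast card_filter_abs_sub_le q i 1
      _ ≤ _ := by
          have : 0 ≤ w * (r * q) := by positivity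
          nlinarith
  have hsum2 : ∑ ij ∈ Finset.range q ×ˢ Finset.range q, ∑ kl ∈ Finset.range q ×ˢ Finset.range q,
      volume.real (arcBand (r * q) w (P ij.1 ij.2) ∩ arcBand (r * q) w (P kl.1 kl.2)) ≤
        178 * r * w ^ 2 * (q : ℝ) ^ 4 := by
    refine (Finset.sum_le_card_nsmul _ _ (178 * r * w ^ 2 * (q : ℝ) ^ 2) fun ij hij => ?_).trans ?_
    · rw [Finset.mem_product, Finset.mem_range, Finset.mem_range] at hij
      exact hone _ hij.1 _ hij.2
    · rw [Finset.card_product, Finset.card_range, nsmul_eq_mul]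
      push_cast
      exact le_of_eq (by ring)
  refine le_trans ?_ (measureReal_biUnion_ge (μ := volume) (Finset.range q ×ˢ Finset.range q)
    (fun ij => arcBand (r * q) w (P ij.1 ij.2)) (fun _ _ => measurableSet_arcBand _ _ _)
    (fun _ _ => by rw [volume_arcBand hw.le]; exact ENNReal.ofReal_ne_top) (1 / (89 * w * q)))
  rw [hsum1]
  refine le_trans (le_of_eq ?_) (sub_le_sub_left (mul_le_mul_of_nonneg_left hsum2 (sq_nonneg _)) _)
  field_simp
  ring

theorem volume_preserving_coords :
    MeasurePreserving (fun z : Plane => (z 0, z 1)) volume volume :=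
  (volume_preserving_finTwoArrow ℝ).comp (PiLp.volume_preserving_ofLp (Fin 2))

theorem abs_dist_sub_le_of_mem_arcBand {R w : ℝ} (hR : 0 < R) {z p : Plane}
    (h : (z 0, z 1) ∈ arcBand R w (p 0, p 1)) : |dist z p - R| ≤ w := by
  obtain ⟨h1, h2⟩ := h
  simp only at h1 h2
  have hnn : 0 ≤ R ^ 2 - (z 0 - p 0) ^ 2 := by
    rw [abs_le] at h1
    nlinarith
  set z' : Plane := !₂[z 0, p 1 + √(R ^ 2 - (z 0 - p 0) ^ 2)] with hz'
  have e1 : dist z' p = R := by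
    rw [EuclideanSpace.dist_eq, Fin.sum_univ_two, Real.dist_eq, Real.dist_eq, sq_abs, sq_abs,
      Real.sqrt_eq_iff_eq_sq (by positivity) hR.le]
    simp [z', Real.sq_sqrt hnn]
  have e2 : dist z z' = |z 1 - p 1 - √(R ^ 2 - (z 0 - p 0) ^ 2)| := by
    rw [EuclideanSpace.dist_eq, Fin.sum_univ_two, Real.dist_eq, Real.dist_eq, sq_abs, sq_abs]
    simp [z', Real.sqrt_sq_eq_abs, sub_sub]
  rw [← e2] at h2
  rw [← e1]
  exact (abs_dist_sub_le z z' p).trans h2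

theorem volume_annulusUnion_ge {r w : ℝ} (hr : 0 < r) (hw : 0 < w) (hw1 : w ≤ 1) {q : ℕ}
    (hq : 1 ≤ q) (hwq : 1 ≤ w * q) {P : Set Plane}
    (hP : ∀ i < q, ∀ j < q, ∃ p ∈ P, p ∈ latticeSquare i j) :
    ENNReal.ofReal (2 * r / 89 * (q : ℝ) ^ 2) ≤ volume (annulusUnion (r * q) w P) := by
  have hR : 0 < r * q := mul_pos hr (by exact_mod_cast hq)
  choose! f hfP hf using hP
  have hge := measureReal_biUnion_arcBand_ge hr hw hw1 hq hwq
    (P := fun i j => (f i j 0, f i j 1)) (fun i hi j hj => (hf i hi j hj).1)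
    (fun i hi j hj => (hf i hi j hj).2)
  refine (ENNReal.ofReal_le_of_le_toReal hge).trans ?_
  rw [← volume_preserving_coords.measure_preimage
    (Finset.measurableSet_biUnion _ fun _ _ => measurableSet_arcBand _ _ _).nullMeasurableSet]
  refine measure_mono fun z hz => ?_
  simp only [Set.mem_preimage, Set.mem_iUnion, Finset.mem_product, Finset.mem_range] at hz
  obtain ⟨⟨i, j⟩, ⟨hi, hj⟩, hz⟩ := hz
  exact Set.mem_biUnion (hfP i hi j hj) (abs_dist_sub_le_of_mem_arcBand hR hz)

/-- Circles of radius `r` centred in a ball of radius `ρ` fill the open annulus. -/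
theorem exists_dist_lt_dist_eq_iff {r ρ : ℝ} (hr : 0 < r) (p y : Plane) :
    (∃ x, dist x p < ρ ∧ dist x y = r) ↔ |dist y p - r| < ρ := by
  constructor
  · rintro ⟨x, hx, rfl⟩
    refine lt_of_le_of_lt ?_ hx
    rw [dist_comm y p, dist_comm x p]
    exact abs_dist_sub_le p x y
  · intro h
    rcases eq_or_ne y p with rfl | hne
    · obtain ⟨v, hv⟩ := exists_norm_eq Plane hr.le
      refine ⟨y + v, ?_, by simp [dist_eq_norm, hv]⟩
      rw [dist_self, zero_sub, abs_neg, abs_of_pos hr] at h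
      simpa [dist_eq_norm, hv] using h
    · have hd : 0 < dist y p := dist_pos.2 hne
      refine ⟨y + (r / dist y p) • (p - y), ?_, ?_⟩
      · rw [dist_eq_norm, show y + (r / dist y p) • (p - y) - p =
          (1 - r / dist y p) • (y - p) by module, norm_smul, Real.norm_eq_abs, ← dist_eq_norm]
        rwa [show dist y p - r = (1 - r / dist y p) * dist y p by field_simp, abs_mul,
          abs_of_pos hd] at h
      · rw [dist_eq_norm, add_sub_cancel_left, norm_smul, ← dist_eq_norm, dist_comm p y,
          Real.norm_of_nonneg (by positivity)]
        field_simp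

theorem circleUnion_thickening {r ρ : ℝ} (hr : 0 < r) (S : Set Plane) :
    circleUnion r (Metric.thickening ρ S) = ⋃ p ∈ S, {y | |dist y p - r| < ρ} := by
  ext y
  simp only [circleUnion, Set.mem_iUnion, Metric.mem_thickening_iff, Set.mem_ofPred_eq,
    exists_prop, ← exists_dist_lt_dist_eq_iff hr]
  tauto

theorem smul_circleUnion_scaledNhd {r s : ℝ} (hr : 0 < r) {q : ℕ} (hq : 1 ≤ q) (P : Set Plane) :
    (q : ℝ) • circleUnion r (scaledNhd s q P) =
      ⋃ p ∈ P, {z | |dist z p - r * q| < (q : ℝ) ^ (1 - 2 / s)} := by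
  have hq0 : (0 : ℝ) < q := by exact_mod_cast hq
  have hscale : (q : ℝ) ^ (1 - 2 / s) = q * scale s q := by
    rw [scale, sub_eq_add_neg, Real.rpow_add hq0, Real.rpow_one]
  ext z
  rw [Set.mem_smul_set_iff_inv_smul_mem₀ hq0.ne', scaledNhd, circleUnion_thickening hr]
  simp only [Set.mem_iUnion, Set.mem_ofPred_eq, Set.biUnion_image, exists_prop]
  refine exists_congr fun p => and_congr_right fun _ => ?_
  rw [dist_smul₀, Real.norm_of_nonneg (by positivity), hscale,
    show (q : ℝ)⁻¹ * dist z p - r = (q : ℝ)⁻¹ * (dist z p - r * q) by field_simp, abs_mul,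
    abs_of_pos (by positivity), inv_mul_lt_iff₀ hq0]

theorem countable_of_pairwise_le_dist {δ : ℝ} (hδ : 0 < δ) {P : Set Plane}
    (hP : P.Pairwise fun p p' => δ ≤ dist p p') : P.Countable := by
  refine Set.PairwiseDisjoint.countable_of_isOpen (s := fun p => Metric.ball p (δ / 2))
    (fun p hp p' hp' hne => ?_) (fun _ _ => Metric.isOpen_ball)
    (fun p _ => ⟨p, Metric.mem_ball_self (by positivity)⟩)
  exact Metric.ball_disjoint_ball (by linarith [hP hp hp' hne])

theorem volume_annulusUnion {R w : ℝ} {P : Set Plane} (hP : P.Countable) :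
    volume (annulusUnion R w P) = volume (⋃ p ∈ P, {z | |dist z p - R| < w}) := by
  refine le_antisymm ?_ (measure_mono (Set.iUnion₂_mono fun p _ z hz => by
    rw [Set.mem_ofPred_eq] at hz ⊢
    exact hz.le))
  have hnull : volume (⋃ p ∈ P, Metric.sphere p (R + w) ∪ Metric.sphere p (R - w)) = 0 :=
    (measure_biUnion_null_iff hP).2 fun p _ => measure_union_null
      (Measure.addHaar_sphere _ _ _) (Measure.addHaar_sphere _ _ _)
  rw [← add_zero (volume (⋃ p ∈ P, {z | |dist z p - R| < w})), ← hnull]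
  refine (measure_mono fun z hz => ?_).trans (measure_union_le _ _)
  simp only [annulusUnion, Set.mem_iUnion, Set.mem_ofPred_eq, exists_prop] at hz
  obtain ⟨p, hp, hz⟩ := hz
  rcases hz.lt_or_eq with h | h
  · exact Or.inl (Set.mem_biUnion hp h)
  · refine Or.inr (Set.mem_biUnion hp ?_)
    rcases eq_or_eq_neg_of_abs_eq h with h | h
    · exact Or.inl (by rw [Metric.mem_sphere]; linarith)
    · exact Or.inr (by rw [Metric.mem_sphere]; linarith)

theorem volume_annulusUnion_eq {r s : ℝ} (hr : 0 < r) {q : ℕ} (hq : 1 ≤ q) {P : Set Plane}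
    (hP : P.Countable) :
    volume (annulusUnion (r * q) ((q : ℝ) ^ (1 - 2 / s)) P) =
      ENNReal.ofReal ((q : ℝ) ^ 2) * volume (circleUnion r (scaledNhd s q P)) := by
  rw [volume_annulusUnion hP, ← smul_circleUnion_scaledNhd hr hq, Measure.addHaar_smul,
    finrank_euclideanSpace_fin, abs_of_nonneg (by positivity)]

end SeparatedAnnuli

theorem mainTheorem10 (s : ℝ) (hs1 : 1 < s) (hs2 : s < 2) (r : ℝ) (hr : 0 < r)
    (δ : ℝ) (hδ : 0 < δ) :
    ∃ c : ℝ, 0 < c ∧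
      ∀ q : ℕ, 1 ≤ q → ∀ P : Set SeparatedAnnuli.Plane,
        SeparatedAnnuli.IsLatticeSample q δ P →
          ENNReal.ofReal c ≤
            MeasureTheory.volume
              (SeparatedAnnuli.circleUnion r (SeparatedAnnuli.scaledNhd s q P)) ∧
          MeasureTheory.volume
              (SeparatedAnnuli.annulusUnion (r * q) ((q : ℝ) ^ (1 - 2 / s)) P) =
            ENNReal.ofReal ((q : ℝ) ^ 2) *
              MeasureTheory.volume
                (SeparatedAnnuli.circleUnion r (SeparatedAnnuli.scaledNhd s q P)) ∧
          ENNReal.ofReal (c * (q : ℝ) ^ 2) ≤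
            MeasureTheory.volume
              (SeparatedAnnuli.annulusUnion (r * q) ((q : ℝ) ^ (1 - 2 / s)) P) := by
  refine ⟨2 * r / 89, by positivity, fun q hq P hP => ?_⟩
  have hq1 : (1 : ℝ) ≤ q := by exact_mod_cast hq
  have hq0 : (0 : ℝ) < q := by linarith
  have hs0 : 0 < s := by linarith
  have hw1 : (q : ℝ) ^ (1 - 2 / s) ≤ 1 := by
    refine Real.rpow_le_one_of_one_le_of_nonpos hq1 ?_
    rw [sub_nonpos, le_div_iff₀ hs0]
    linarith
  have hwq : 1 ≤ (q : ℝ) ^ (1 - 2 / s) * q := by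
    rw [← Real.rpow_add_one hq0.ne']
    refine Real.one_le_rpow hq1 ?_
    have : 2 / s ≤ 2 := by
      rw [div_le_iff₀ hs0]
      linarith
    linarith
  have heq := SeparatedAnnuli.volume_annulusUnion_eq (s := s) hr hq
    (SeparatedAnnuli.countable_of_pairwise_le_dist hδ hP.separated)
  have hge := SeparatedAnnuli.volume_annulusUnion_ge hr (Real.rpow_pos_of_pos hq0 _) hw1 hq hwq
    hP.exists_mem_latticeSquare
  refine ⟨?_, heq, hge⟩
  rw [heq, mul_comm, ENNReal.ofReal_mul (by positivity)] at hge
  exact (ENNReal.mul_le_mul_iff_right (by simpa using hq0.ne') ENNReal.ofReal_ne_top).1 hge
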